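/- Let $M$ be a smooth $3$-manifold with a Weyl structure of Euclidean (Riemannian) signature, i.e. a conformal class $[g]$ of Riemannian metrics and a torsion-free covariant derivative $\nabla$ such that every representative $g$ admits a $1$-form $\nu$ with $\nabla g=-2\nu\otimes g$. Let $\mathfrak h$ be a proper Lie subalgebra of $\mathfrak{co}(3)=\mathbb R\oplus\mathfrak{so}(3)$, different from $\mathfrak{so}(3)$ (for instance, up to conjugacy, the algebra $E=\{p\,\mathrm{id}+bJ : p,b\in\mathbb R\}$ or $G_q=\{p(\mathrm{id}+qJ) : p\in\mathbb R\}$, $q\in\mathbb R$, where $J$ generates the rotations about an axis). Suppose that the holonomy of the Weyl structure is reduced to $\mathfrak h$: around each point of $M$ there is a local frame $(e_i)$, orthonormal for some local representative of $[g]$, in which the matrix $(\Gamma^i{}_j)$ of connection $1$-forms, $\nabla e_j=\Gamma^i{}_j\otimes e_i$, takes values in $\mathfrak h$. If the structure is Einstein–Weyl, i.e. the Ricci tensor $\mathrm{Ric}_{ij}=\Omega^k{}_{ikj}$ of the curvature $\Omega$ of $\nabla$ satisfies $\mathrm{Ric}_{(ij)}-\tfrac13 R\,g_{ij}=0$ with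 $R=\mathrm{Ric}_{ij}g^{ij}$, then it is flat, i.e. $\Omega=0$. -/

import Mathlib

open Bundle Set
open scoped Manifold ContDiff Topology

attribute [local instance 100] LieRing.ofAssociativeRing

/-! ## The conformal Lie algebra -/

/-- The Lie algebra `co(n) = ℝ ⊕ so(n)` of the conformal group `CO(n) = ℝ₊ × O(n)`: the matrices
whose symmetric part is a multiple of the identity. -/
def conformalLieAlgebra (n : ℕ) : LieSubalgebra ℝ (Matrix (Fin n) (Fin n) ℝ) where
  carrier := {A | ∃ p : ℝ, A + A.transpose = (2 * p) • (1 : Matrix (Fin n) (Fin n) ℝ)}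
  zero_mem' := ⟨0, by simp⟩
  add_mem' := by
    rintro A B ⟨p, hp⟩ ⟨q, hq⟩
    refine ⟨p + q, ?_⟩
    rw [Matrix.transpose_add, add_add_add_comm, hp, hq, mul_add, add_smul]
  smul_mem' := by
    rintro c A ⟨p, hp⟩
    refine ⟨c * p, ?_⟩
    rw [Matrix.transpose_smul, ← smul_add, hp, smul_smul]
    congr 1
    ring
  lie_mem' := by
    rintro A B ⟨p, hp⟩ ⟨q, hq⟩
    refine ⟨0, ?_⟩
    have hA : A.transpose = (2 * p) • (1 : Matrix (Fin n) (Fin n) ℝ) - A := by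
      rw [← hp]; abel
    have hB : B.transpose = (2 * q) • (1 : Matrix (Fin n) (Fin n) ℝ) - B := by
      rw [← hq]; abel
    rw [Ring.lie_def, Matrix.transpose_sub, Matrix.transpose_mul, Matrix.transpose_mul, hA, hB]
    simp only [sub_mul, mul_sub, Matrix.smul_mul, Matrix.mul_smul, Matrix.one_mul, Matrix.mul_one]
    rw [mul_zero, zero_smul, smul_comm (2 * p) (2 * q)]
    abel

/-! ## Weyl structures of Riemannian signature -/

section Weyl

variable {n : ℕ} {M : Type*} [TopologicalSpace M] [ChartedSpace (EuclideanSpace ℝ (Fin n)) M]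

/-- The vector field `X` is differentiable at `x`. -/
def DifferentiableFieldAt [IsManifold (𝓡 n) ∞ M] (X : Π x : M, TangentSpace (𝓡 n) x) (x : M) :
    Prop :=
  MDifferentiableAt (𝓡 n) ((𝓡 n).prod 𝓘(ℝ, EuclideanSpace ℝ (Fin n)))
    (fun y ↦ TotalSpace.mk' (EuclideanSpace ℝ (Fin n)) y (X y)) x

/-- The vector field `X` is smooth on the set `u`. -/
def SmoothFieldOn [IsManifold (𝓡 n) ∞ M] (X : Π x : M, TangentSpace (𝓡 n) x) (u : Set M) : Prop :=
  ContMDiffOn (𝓡 n) ((𝓡 n).prod 𝓘(ℝ, EuclideanSpace ℝ (Fin n))) ∞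
    (fun y ↦ TotalSpace.mk' (EuclideanSpace ℝ (Fin n)) y (X y)) u

/-- `∇ g = - 2 ν ⊗ g`, that is
`d(g(X, Y))(v) - g(∇_v X, Y) - g(X, ∇_v Y) = - 2 ν(v) g(X, Y)` for all vector fields `X`, `Y`. -/
def IsWeylForm [IsManifold (𝓡 n) ∞ M]
    (nabla : CovariantDerivative (𝓡 n) (EuclideanSpace ℝ (Fin n))
      (TangentSpace (𝓡 n) : M → Type _))
    (g : ContMDiffRiemannianMetric (𝓡 n) ∞ (EuclideanSpace ℝ (Fin n))
      (TangentSpace (𝓡 n) : M → Type _))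
    (ν : Π x : M, TangentSpace (𝓡 n) x →L[ℝ] ℝ) : Prop :=
  ∀ (X Y : Π x : M, TangentSpace (𝓡 n) x) (x : M), DifferentiableFieldAt X x → DifferentiableFieldAt Y x →
    ∀ v : TangentSpace (𝓡 n) x,
      mvfderiv (𝓡 n) (fun y ↦ g.inner y (X y) (Y y)) x v
          - g.inner x (nabla X x v) (Y x) - g.inner x (X x) (nabla Y x v)
        = -2 * ν x v * g.inner x (X x) (Y x)

variable (n M) in
/-- A (smooth) Weyl structure of Riemannian signature on an `n`-manifold `M`: a conformal class of
Riemannian metrics and a torsion-free covariant derivative `∇` such that for each representative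
`g` there is a 1-form `ν` with `∇ g = - 2 ν ⊗ g`. -/
structure WeylStructure [IsManifold (𝓡 n) ∞ M] where
  /-- The conformal class `[g]`, as the set of its representatives. -/
  metrics : Set (ContMDiffRiemannianMetric (𝓡 n) ∞ (EuclideanSpace ℝ (Fin n))
    (TangentSpace (𝓡 n) : M → Type _))
  nonempty : metrics.Nonempty
  mem_iff : ∀ g ∈ metrics, ∀ g', g' ∈ metrics ↔ ∃ φ : M → ℝ, ContMDiff (𝓡 n) 𝓘(ℝ, ℝ) ∞ φ ∧
    ∀ (x : M) (v w : TangentSpace (𝓡 n) x),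
      g'.inner x v w = Real.exp (2 * φ x) * g.inner x v w
  /-- The Weyl connection; `nabla X x v` is `∇_v X` at `x`. -/
  nabla : CovariantDerivative (𝓡 n) (EuclideanSpace ℝ (Fin n)) (TangentSpace (𝓡 n) : M → Type _)
  /-- Smoothness: `∇ X` is smooth on each open set on which `X` is. -/
  smooth : ∀ u : Set M, IsOpen u →
    ContMDiffCovariantDerivativeOn (EuclideanSpace ℝ (Fin n)) ∞ nabla.toFun u
  torsionFree : ∀ (X Y : Π x : M, TangentSpace (𝓡 n) x) (x : M),
    DifferentiableFieldAt X x → DifferentiableFieldAt Y x →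
      nabla Y x (X x) - nabla X x (Y x) = VectorField.mlieBracket (𝓡 n) X Y x
  exists_form : ∀ g ∈ metrics, ∃ ν : Π x : M, TangentSpace (𝓡 n) x →L[ℝ] ℝ,
    ContMDiff (𝓡 n) ((𝓡 n).prod 𝓘(ℝ, EuclideanSpace ℝ (Fin n) →L[ℝ] ℝ)) ∞
      (fun x ↦ TotalSpace.mk' (EuclideanSpace ℝ (Fin n) →L[ℝ] ℝ)
        (E := fun x : M ↦ TangentSpace (𝓡 n) x →L[ℝ] Bundle.Trivial M ℝ x) x (ν x)) ∧
    IsWeylForm nabla g ν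

namespace WeylStructure

variable [IsManifold (𝓡 n) ∞ M] (W : WeylStructure n M)

/-- The curvature `R(X, Y) Z = ∇_X ∇_Y Z - ∇_Y ∇_X Z - ∇_[X, Y] Z` at the point `x`. -/
noncomputable def curvature (X Y Z : Π x : M, TangentSpace (𝓡 n) x) (x : M) :
    TangentSpace (𝓡 n) x :=
  W.nabla (fun y ↦ W.nabla Z y (Y y)) x (X x) - W.nabla (fun y ↦ W.nabla Z y (X y)) x (Y x)
    - W.nabla Z x (VectorField.mlieBracket (𝓡 n) X Y x)

/-- The Weyl structure is flat: its curvature vanishes identically. -/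
def IsFlat : Prop :=
  ∀ (u : Set M) (X Y Z : Π x : M, TangentSpace (𝓡 n) x), IsOpen u →
    SmoothFieldOn X u → SmoothFieldOn Y u → SmoothFieldOn Z u →
    ∀ x ∈ u, W.curvature X Y Z x = 0

variable {u : Set M} {e : Fin n → Π x : M, TangentSpace (𝓡 n) x}

/-- The components `Ric_ij = Ω^k_ikj = θ^k(R(e_k, e_j) e_i)` of the Ricci tensor in a local frame
`e` with dual coframe `θ`. -/
noncomputable def ricci (he : IsLocalFrameOn (𝓡 n) (EuclideanSpace ℝ (Fin n)) ∞ e u) (x : M) :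
    Matrix (Fin n) (Fin n) ℝ :=
  Matrix.of fun i j ↦ ∑ k, he.coeff k x (W.curvature (e k) (e j) (e i) x)

/-- The components `g_ij = g(e_i, e_j)` of a metric in a family of vector fields. -/
noncomputable def gram
    (g : ContMDiffRiemannianMetric (𝓡 n) ∞ (EuclideanSpace ℝ (Fin n))
      (TangentSpace (𝓡 n) : M → Type _))
    (e : Fin n → Π x : M, TangentSpace (𝓡 n) x) (x : M) : Matrix (Fin n) (Fin n) ℝ :=
  Matrix.of fun i j ↦ g.inner x (e i x) (e j x)

/-- The Ricci scalar `R = Ric_ij g^ij`, computed in a local frame. -/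
noncomputable def scalar
    (g : ContMDiffRiemannianMetric (𝓡 n) ∞ (EuclideanSpace ℝ (Fin n))
      (TangentSpace (𝓡 n) : M → Type _))
    (he : IsLocalFrameOn (𝓡 n) (EuclideanSpace ℝ (Fin n)) ∞ e u) (x : M) : ℝ :=
  ∑ i, ∑ j, W.ricci he x i j * (gram g e x)⁻¹ i j

/-- The Einstein-Weyl equations `Ric_(ij) - (1/n) R g_ij = 0`. -/
def IsEinsteinWeyl : Prop :=
  ∀ g ∈ W.metrics, ∀ (u : Set M) (e : Fin n → Π x : M, TangentSpace (𝓡 n) x), IsOpen u →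
    ∀ he : IsLocalFrameOn (𝓡 n) (EuclideanSpace ℝ (Fin n)) ∞ e u, ∀ x ∈ u, ∀ i j : Fin n,
      (W.ricci he x i j + W.ricci he x j i) / 2 - 1 / (n : ℝ) * W.scalar g he x * gram g e x i j
        = 0

/-- The local frame `e` on `u` is a section of the bundle of conformal frames: it is orthonormal,
up to a positive factor, for the metrics of the conformal class. -/
def IsConformalFrame (e : Fin n → Π x : M, TangentSpace (𝓡 n) x) (u : Set M) : Prop :=
  ∀ g ∈ W.metrics, ∀ x ∈ u, ∃ r : ℝ, 0 < r ∧ gram g e x = r • (1 : Matrix (Fin n) (Fin n) ℝ)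

/-- The matrix `(Γ^i_j(v))` of connection 1-forms in a local frame, `∇_v e_j = Γ^i_j(v) e_i`. -/
noncomputable def connectionMatrix
    (he : IsLocalFrameOn (𝓡 n) (EuclideanSpace ℝ (Fin n)) ∞ e u) (x : M)
    (v : TangentSpace (𝓡 n) x) : Matrix (Fin n) (Fin n) ℝ :=
  Matrix.of fun i j ↦ he.coeff i x (W.nabla (e j) x v)

/-- The holonomy of the Weyl structure is reduced to the Lie algebra `h`: around each point there
is a local conformal frame in which the connection 1-form takes values in `h`. -/
def HolonomyReducedTo (h : LieSubalgebra ℝ (Matrix (Fin n) (Fin n) ℝ)) : Prop :=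
  ∀ x₀ : M, ∃ (u : Set M) (e : Fin n → Π x : M, TangentSpace (𝓡 n) x)
    (he : IsLocalFrameOn (𝓡 n) (EuclideanSpace ℝ (Fin n)) ∞ e u),
    IsOpen u ∧ x₀ ∈ u ∧ W.IsConformalFrame e u ∧
      ∀ x ∈ u, ∀ v : TangentSpace (𝓡 n) x, W.connectionMatrix he x v ∈ h

end WeylStructure

end Weyl

/-!
Modulo multiples of the identity, a subalgebra `h` of `co(3)` is a subalgebra of `so(3) ≅ (ℝ³, ×)`.
If `h` contains two elements whose rotational parts `a`, `b` are not parallel, then it contains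
`a × b`, `a × (a × b)` and `b × (a × b)`, hence all of `so(3)`, so it is `so(3)` or `co(3)`. The
excluded cases aside, `h` therefore lies in `span {1, N}` for a single antisymmetric matrix `N`
(`exists_rotation_generator`).

In a frame whose connection matrix takes values in `h`, the curvature matrix `dΓ + Γ ∧ Γ` takes
values in `h` too (`curvature_coeff_mem`), so `R(e_a, e_b) = F_ab 1 + B_ab N`. Write `f`, `b` and
`ν` for the vectors dual to `F`, `B` and `N`. The first Bianchi identity (`curvature_cyclic`: the
Jacobi identity together with the vanishing of the torsion) says `f + ν × b = 0`, while the
Ricci tensor has symmetric part `ν ⊙ b - (ν · b) g`. The Einstein-Weyl equations thus say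
that the trace-free part of `ν ⊙ b` vanishes; this forces `ν ⊗ b = 0`, then `f = 0`, and all
components of the curvature vanish (`curvature_components_eq_zero`).

What remains is that the curvature is determined by its components
(`curvature_eq_zero_of_frame`). Tensoriality of `R(X, Y) Z` in `X` and `Y` follows from the Leibniz
rules; the cyclic identity moves `Z` into one of these two slots, which makes a separate proof of
tensoriality in `Z` unnecessary.
-/

/-! ### Pointwise algebra of the curvature components -/

/-- Here `R a b k c` is the component `θ^k(R(e_a, e_b) e_c)` in a conformal frame. If all the
endomorphisms `R a b` lie in the span of the identity and of one antisymmetric matrix, then the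
first Bianchi identity and the Einstein-Weyl equations make `R` vanish. -/
theorem curvature_components_eq_zero {R : Fin 3 → Fin 3 → Matrix (Fin 3) (Fin 3) ℝ}
    {N : Matrix (Fin 3) (Fin 3) ℝ} (hN : N.transpose = -N)
    (hR : ∀ a b, ∃ p q : ℝ, R a b = p • (1 : Matrix (Fin 3) (Fin 3) ℝ) + q • N)
    (anti : ∀ a b, R a b = -R b a)
    (bianchi : ∀ a b c k, R a b k c + R b c k a + R c a k b = 0)
    (ew : ∀ i j, ((∑ k, R k j k i) + ∑ k, R k i k j) / 2
      - 1 / 3 * (∑ l, ∑ k, R k l k l) * (1 : Matrix (Fin 3) (Fin 3) ℝ) i j = 0)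
    (a b : Fin 3) : R a b = 0 := by
  -- `f` and `b` are the vectors dual to the 2-forms which are the coefficients of `1` and `N`.
  obtain ⟨f₀, b₀, h₀⟩ := hR 1 2
  obtain ⟨f₁, b₁, h₁⟩ := hR 2 0
  obtain ⟨f₂, b₂, h₂⟩ := hR 0 1
  have self (i : Fin 3) : R i i = 0 := by
    ext k l
    exact self_eq_neg.mp congr($(anti i i) k l)
  have h₀' : R 2 1 = -(f₀ • (1 : Matrix (Fin 3) (Fin 3) ℝ) + b₀ • N) := by rw [anti, h₀]
  have h₁' : R 0 2 = -(f₁ • (1 : Matrix (Fin 3) (Fin 3) ℝ) + b₁ • N) := by rw [anti, h₁]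
  have h₂' : R 1 0 = -(f₂ • (1 : Matrix (Fin 3) (Fin 3) ℝ) + b₂ • N) := by rw [anti, h₂]
  have hN' (i j : Fin 3) : N j i = -N i j := congr($hN i j)
  have n00 : N 0 0 = 0 := self_eq_neg.mp (hN' 0 0)
  have n11 : N 1 1 = 0 := self_eq_neg.mp (hN' 1 1)
  have n22 : N 2 2 = 0 := self_eq_neg.mp (hN' 2 2)
  have n21 := hN' 1 2
  have n02 := hN' 2 0
  have n10 := hN' 0 1
  have B (k : Fin 3) := bianchi 0 1 2 k
  have B0 := B 0
  have B1 := B 1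
  have B2 := B 2
  have e00 := ew 0 0
  have e11 := ew 1 1
  have e01 := ew 0 1
  have e02 := ew 0 2
  have e12 := ew 1 2
  simp [Fin.sum_univ_three, h₀, h₁, h₂, h₀', h₁', h₂', self, n00, n11, n22, n21, n02, n10]
    at B0 B1 B2 e00 e11 e01 e02 e12
  -- The equations say that the trace-free symmetric part of `b ⊗ ν` vanishes, where `ν` is the axis
  -- of `N`. Applied to two components `u`, `u'` of `b` and the same components `v`, `v'` of `ν`,
  -- the following fact yields `b ⊗ ν = 0`.
  have pair {u v u' v' : ℝ} (h : u * v = u' * v') (h' : u * v' = -(u' * v)) :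
      u * v = 0 ∧ u * v' = 0 ∧ u' * v = 0 := by
    have hs : (u * v) ^ 2 + (u * v') ^ 2 = 0 := by
      linear_combination (u * v) * h + (u * v') * h'
    have h₁ : u * v = 0 := by nlinarith [sq_nonneg (u * v), sq_nonneg (u * v')]
    have h₂ : u * v' = 0 := by nlinarith [sq_nonneg (u * v), sq_nonneg (u * v')]
    exact ⟨h₁, h₂, by linarith⟩
  obtain ⟨p22, p21, p12⟩ := pair (u := b₂) (v := N 0 1) (u' := b₁) (v' := N 2 0)
    (by linarith) (by linarith)
  obtain ⟨p00, p02, p20⟩ := pair (u := b₀) (v := N 1 2) (u' := b₂) (v' := N 0 1)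
    (by linarith) (by linarith)
  obtain ⟨p11, p10, p01⟩ := pair (u := b₁) (v := N 2 0) (u' := b₀) (v' := N 1 2)
    (by linarith) (by linarith)
  have flat {q : ℝ} (h₁ : q * N 0 1 = 0) (h₂ : q * N 1 2 = 0) (h₃ : q * N 2 0 = 0) :
      q • N = 0 := by
    ext i j
    fin_cases i <;> fin_cases j <;> simp [n00, n11, n22, n21, n02, n10, -mul_eq_zero, h₁, h₂, h₃]
  have g₀ : f₀ = 0 := by linarith
  have g₁ : f₁ = 0 := by linarith
  have g₂ : f₂ = 0 := by linarith
  rw [flat (by linarith) (by linarith) (by linarith), g₀] at h₀ h₀'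
  rw [flat (by linarith) (by linarith) (by linarith), g₁] at h₁ h₁'
  rw [flat (by linarith) (by linarith) (by linarith), g₂] at h₂ h₂'
  fin_cases a <;> fin_cases b <;> simp [self, h₀, h₁, h₂, h₀', h₁', h₂']

/-! ### Subalgebras of the conformal Lie algebra in dimension three -/

/-- The antisymmetric matrix of `w ↦ v × w`. -/
def crossMatrix (v : Fin 3 → ℝ) : Matrix (Fin 3) (Fin 3) ℝ :=
  !![0, -v 2, v 1; v 2, 0, -v 0; -v 1, v 0, 0]

theorem crossMatrix_transpose (v : Fin 3 → ℝ) : (crossMatrix v).transpose = -crossMatrix v := by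
  ext i j
  fin_cases i <;> fin_cases j <;> simp [crossMatrix]

theorem crossMatrix_add (v w : Fin 3 → ℝ) :
    crossMatrix (v + w) = crossMatrix v + crossMatrix w := by
  ext i j
  fin_cases i <;> fin_cases j <;> simp [crossMatrix] <;> ring

theorem crossMatrix_smul (c : ℝ) (v : Fin 3 → ℝ) : crossMatrix (c • v) = c • crossMatrix v := by
  ext i j
  fin_cases i <;> fin_cases j <;> simp [crossMatrix]

theorem lie_smul_one_add_crossMatrix (p q : ℝ) (v w : Fin 3 → ℝ) :
    ⁅p • (1 : Matrix (Fin 3) (Fin 3) ℝ) + crossMatrix v, q • 1 + crossMatrix w⁆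
      = crossMatrix (crossProduct v w) := by
  ext i j
  fin_cases i <;> fin_cases j <;>
    simp [crossMatrix, Ring.lie_def, Matrix.mul_apply, Fin.sum_univ_three, cross_apply] <;> ring

theorem exists_eq_smul_one_add_crossMatrix {A : Matrix (Fin 3) (Fin 3) ℝ}
    (hA : A ∈ conformalLieAlgebra 3) : ∃ (p : ℝ) (v : Fin 3 → ℝ), A = p • 1 + crossMatrix v := by
  obtain ⟨p, hp⟩ := hA
  refine ⟨p, ![A 2 1, A 0 2, A 1 0], ?_⟩
  have h (i j : Fin 3) := congr($hp i j)
  ext i j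
  have hij := h i j
  fin_cases i <;> fin_cases j <;> simp [crossMatrix] at hij ⊢ <;> linarith

/-- The expansion of `v` in the basis `a × w`, `b × w`, `w` of `ℝ³`, where `w = a × b`, with the
denominator `w · w` cleared. -/
theorem cross_basis_expansion (a b v : Fin 3 → ℝ) :
    (crossProduct a b ⬝ᵥ crossProduct a b) • v
      = -(v ⬝ᵥ b) • crossProduct a (crossProduct a b)
        + (v ⬝ᵥ a) • crossProduct b (crossProduct a b)
        + (v ⬝ᵥ crossProduct a b) • crossProduct a b := by
  ext i
  fin_cases i <;> simp [cross_apply, dotProduct, Fin.sum_univ_three] <;> ring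

/-- A subalgebra with two non-parallel rotational parts contains `so(3)`: brackets do not see the
homothetic parts and generate a basis of `so(3)`. -/
theorem crossMatrix_mem_of_cross_ne_zero (h : LieSubalgebra ℝ (Matrix (Fin 3) (Fin 3) ℝ))
    {p q : ℝ} {a b : Fin 3 → ℝ} (ha : p • 1 + crossMatrix a ∈ h) (hb : q • 1 + crossMatrix b ∈ h)
    (hab : crossProduct a b ≠ 0) (v : Fin 3 → ℝ) : crossMatrix v ∈ h := by
  have hw : crossMatrix (crossProduct a b) ∈ h := by
    rw [← lie_smul_one_add_crossMatrix p q]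
    exact h.lie_mem ha hb
  have hl {r : ℝ} {c : Fin 3 → ℝ} (hc : r • 1 + crossMatrix c ∈ h) :
      crossMatrix (crossProduct c (crossProduct a b)) ∈ h := by
    rw [← lie_smul_one_add_crossMatrix r 0, zero_smul, zero_add]
    exact h.lie_mem hc hw
  have hne : crossProduct a b ⬝ᵥ crossProduct a b ≠ 0 := by
    rwa [ne_eq, dotProduct_self_eq_zero]
  have hv := congr((crossProduct a b ⬝ᵥ crossProduct a b)⁻¹ • crossMatrix $(cross_basis_expansion a b v))
  rw [crossMatrix_smul, inv_smul_smul₀ hne] at hv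
  simp only [hv, crossMatrix_add, crossMatrix_smul]
  exact h.smul_mem _ (h.add_mem (h.add_mem (h.smul_mem _ (hl ha)) (h.smul_mem _ (hl hb)))
    (h.smul_mem _ hw))

/-- A proper subalgebra of `co(3)` other than `so(3)` consists of combinations of the identity and a
single infinitesimal rotation, which is `0` if there are only homotheties. -/
theorem exists_rotation_generator {h : LieSubalgebra ℝ (Matrix (Fin 3) (Fin 3) ℝ)}
    (h_proper : h < conformalLieAlgebra 3) (h_ne_so : h ≠ LieAlgebra.Orthogonal.so (Fin 3) ℝ) :
    ∃ N : Matrix (Fin 3) (Fin 3) ℝ, N.transpose = -N ∧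
      ∀ A ∈ h, ∃ p q : ℝ, A = p • (1 : Matrix (Fin 3) (Fin 3) ℝ) + q • N := by
  have hle := h_proper.le
  by_cases hcross : ∃ (p q : ℝ) (a b : Fin 3 → ℝ), p • 1 + crossMatrix a ∈ h ∧
      q • 1 + crossMatrix b ∈ h ∧ crossProduct a b ≠ 0
  · obtain ⟨p, q, a, b, ha, hb, hab⟩ := hcross
    have hmem := crossMatrix_mem_of_cross_ne_zero h ha hb hab
    exfalso
    by_cases hs : ∃ (r : ℝ) (c : Fin 3 → ℝ), r • 1 + crossMatrix c ∈ h ∧ r ≠ 0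
    · obtain ⟨r, c, hc, hr⟩ := hs
      have h1 : (1 : Matrix (Fin 3) (Fin 3) ℝ) ∈ h := by
        have := h.smul_mem r⁻¹ (h.sub_mem hc (hmem c))
        rwa [add_sub_cancel_right, inv_smul_smul₀ hr] at this
      refine h_proper.not_ge fun A hA ↦ ?_
      obtain ⟨s, v, rfl⟩ := exists_eq_smul_one_add_crossMatrix hA
      exact h.add_mem (h.smul_mem s h1) (hmem v)
    · push Not at hs
      refine h_ne_so (le_antisymm (fun A hA ↦ ?_) fun A hA ↦ ?_)
      · obtain ⟨s, v, rfl⟩ := exists_eq_smul_one_add_crossMatrix (hle hA)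
        rw [LieAlgebra.Orthogonal.mem_so, hs s v hA, zero_smul, zero_add, crossMatrix_transpose]
      · rw [LieAlgebra.Orthogonal.mem_so] at hA
        have hco : A ∈ conformalLieAlgebra 3 := ⟨0, by simp [hA]⟩
        obtain ⟨s, v, rfl⟩ := exists_eq_smul_one_add_crossMatrix hco
        have hs0 : s = 0 := by
          have := congr($hA 0 0)
          simp [crossMatrix] at this
          linarith
        rw [hs0, zero_smul, zero_add]
        exact hmem v
  · push Not at hcross
    by_cases hz : ∃ (p : ℝ) (a : Fin 3 → ℝ), p • 1 + crossMatrix a ∈ h ∧ a ≠ 0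
    · obtain ⟨p, a, ha, ha0⟩ := hz
      refine ⟨crossMatrix a, crossMatrix_transpose a, fun A hA ↦ ?_⟩
      obtain ⟨s, v, rfl⟩ := exists_eq_smul_one_add_crossMatrix (hle hA)
      have hne : a ⬝ᵥ a ≠ 0 := by rwa [ne_eq, dotProduct_self_eq_zero]
      have hv : v = ((a ⬝ᵥ v) / (a ⬝ᵥ a)) • a := by
        have h0 : (a ⬝ᵥ a) • v = (a ⬝ᵥ v) • a - crossProduct a (crossProduct a v) := by
          ext i
          fin_cases i <;> simp [cross_apply, dotProduct, Fin.sum_univ_three] <;> ring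
        rw [hcross p s a v ha hA, map_zero, sub_zero] at h0
        rw [div_eq_inv_mul, mul_smul, ← h0, inv_smul_smul₀ hne]
      exact ⟨s, (a ⬝ᵥ v) / (a ⬝ᵥ a), by rw [← crossMatrix_smul, ← hv]⟩
    · push Not at hz
      refine ⟨0, by simp, fun A hA ↦ ?_⟩
      obtain ⟨s, v, rfl⟩ := exists_eq_smul_one_add_crossMatrix (hle hA)
      refine ⟨s, 0, ?_⟩
      have h0 : crossMatrix 0 = 0 := by simpa using crossMatrix_smul 0 0
      rw [hz s v hA, h0, smul_zero]

/-! ### Tensoriality of the curvature and the first Bianchi identity -/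

namespace WeylStructure

variable {n : ℕ} {M : Type*} [TopologicalSpace M] [ChartedSpace (EuclideanSpace ℝ (Fin n)) M]
  [IsManifold (𝓡 n) ∞ M] (W : WeylStructure n M)
  {u : Set M} {x : M} {X Y Z : Π x : M, TangentSpace (𝓡 n) x}

theorem _root_.SmoothFieldOn.differentiableFieldAt (hX : SmoothFieldOn X u) (hu : IsOpen u)
    (hx : x ∈ u) : DifferentiableFieldAt X x :=
  (hX.contMDiffAt (hu.mem_nhds hx)).mdifferentiableAt (by simp)

theorem contMDiffOn_nabla (hu : IsOpen u) (hZ : SmoothFieldOn Z u) :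
    ContMDiffOn (𝓡 n) ((𝓡 n).prod 𝓘(ℝ, EuclideanSpace ℝ (Fin n) →L[ℝ] EuclideanSpace ℝ (Fin n))) ∞
      (fun y ↦ TotalSpace.mk' (EuclideanSpace ℝ (Fin n) →L[ℝ] EuclideanSpace ℝ (Fin n))
        (E := fun y : M ↦ TangentSpace (𝓡 n) y →L[ℝ] TangentSpace (𝓡 n) y) y (W.nabla Z y)) u :=
  (W.smooth u hu).contMDiff (σ := Z) hZ

theorem smoothFieldOn_nabla (hu : IsOpen u) (hZ : SmoothFieldOn Z u) (hY : SmoothFieldOn Y u) :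
    SmoothFieldOn (fun y ↦ W.nabla Z y (Y y)) u :=
  (W.contMDiffOn_nabla hu hZ).clm_bundle_apply hY

theorem differentiableFieldAt_nabla (hu : IsOpen u) (hx : x ∈ u) (hZ : SmoothFieldOn Z u)
    (hY : DifferentiableFieldAt Y x) :
    DifferentiableFieldAt (fun y ↦ W.nabla Z y (Y y)) x :=
  (((W.contMDiffOn_nabla hu hZ).contMDiffAt (hu.mem_nhds hx)).mdifferentiableAt
    (by simp)).clm_bundle_apply hY

theorem nabla_congr (hX : DifferentiableFieldAt X x) (hY : DifferentiableFieldAt Y x)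
    (h : ∀ᶠ y in 𝓝 x, X y = Y y) : W.nabla X x = W.nabla Y x :=
  W.nabla.isCovariantDerivativeOn.congr_of_eventuallyEq (s := univ) hX hY Filter.univ_mem h

theorem nabla_sub (hX : DifferentiableFieldAt X x) (hY : DifferentiableFieldAt Y x) :
    W.nabla (X - Y) x = W.nabla X x - W.nabla Y x := by
  have h := W.nabla.isCovariantDerivativeOnUniv.add (x := x) (mdifferentiableAt_sub_section hX hY) hY
  rw [sub_add_cancel] at h
  exact eq_sub_of_add_eq h.symm

theorem curvature_swap : W.curvature X Y Z x = -W.curvature Y X Z x := by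
  simp only [curvature]
  rw [VectorField.mlieBracket_swap_apply]
  simp only [map_neg]
  abel

theorem tensorialAt_curvature_left (hu : IsOpen u) (hx : x ∈ u) (hZ : SmoothFieldOn Z u) :
    TensorialAt (𝓡 n) (EuclideanSpace ℝ (Fin n)) (fun X ↦ W.curvature X Y Z x) x where
  smul {f X} hf hX := by
    have h := W.nabla.isCovariantDerivativeOnUniv.leibniz (x := x)
      (W.differentiableFieldAt_nabla hu hx hZ hX) hf
    have e : (fun y ↦ W.nabla Z y ((f • X) y)) = f • fun y ↦ W.nabla Z y (X y) := by
      funext y; simp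
    simp only [curvature]
    rw [e, VectorField.mlieBracket_smul_left hf hX]
    erw [h]
    simp
    module
  add {X X'} hX hX' := by
    have h := W.nabla.isCovariantDerivativeOnUniv.add (x := x)
      (W.differentiableFieldAt_nabla hu hx hZ hX) (W.differentiableFieldAt_nabla hu hx hZ hX')
    have e : (fun y ↦ W.nabla Z y ((X + X') y))
        = (fun y ↦ W.nabla Z y (X y)) + fun y ↦ W.nabla Z y (X' y) := by
      funext y; simp
    simp only [curvature]
    rw [e, VectorField.mlieBracket_add_left hX hX']
    erw [h]
    simp
    abel

theorem tensorialAt_curvature_right (hu : IsOpen u) (hx : x ∈ u) (hZ : SmoothFieldOn Z u) :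
    TensorialAt (𝓡 n) (EuclideanSpace ℝ (Fin n)) (fun Y ↦ W.curvature X Y Z x) x := by
  have h := W.tensorialAt_curvature_left (Y := X) hu hx hZ
  simp only [W.curvature_swap (X := X)]
  exact ⟨fun hf hY ↦ by rw [h.smul hf hY, smul_neg], fun hY hY' ↦ by rw [h.add hY hY', neg_add]⟩

/-- The first Bianchi identity. -/
theorem curvature_cyclic (hu : IsOpen u) (hx : x ∈ u) (hX : SmoothFieldOn X u)
    (hY : SmoothFieldOn Y u) (hZ : SmoothFieldOn Z u) :
    W.curvature X Y Z x + W.curvature Y Z X x + W.curvature Z X Y x = 0 := by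
  -- As the torsion vanishes, `∇_X (∇_Y Z - ∇_Z Y) - ∇_[Y, Z] X = [X, [Y, Z]]`; the cyclic sum of
  -- the left sides is that of the curvatures, and the cyclic sum of the right sides is zero.
  have key {X Y Z : Π x : M, TangentSpace (𝓡 n) x} (hX : SmoothFieldOn X u)
      (hY : SmoothFieldOn Y u) (hZ : SmoothFieldOn Z u) :
      W.nabla (fun y ↦ W.nabla Z y (Y y)) x (X x) - W.nabla (fun y ↦ W.nabla Y y (Z y)) x (X x)
        - W.nabla X x (VectorField.mlieBracket (𝓡 n) Y Z x)
      = VectorField.mlieBracket (𝓡 n) X (VectorField.mlieBracket (𝓡 n) Y Z) x := by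
    have h₁ := (W.smoothFieldOn_nabla hu hZ hY).differentiableFieldAt hu hx
    have h₂ := (W.smoothFieldOn_nabla hu hY hZ).differentiableFieldAt hu hx
    have ev : ∀ᶠ y in 𝓝 x, VectorField.mlieBracket (𝓡 n) Y Z y
        = W.nabla Z y (Y y) - W.nabla Y y (Z y) := by
      filter_upwards [hu.mem_nhds hx] with y hy
      exact (W.torsionFree Y Z y (hY.differentiableFieldAt hu hy)
        (hZ.differentiableFieldAt hu hy)).symm
    have hd : DifferentiableFieldAt (VectorField.mlieBracket (𝓡 n) Y Z) x :=
      MDifferentiableAt.congr_of_eventuallyEq (mdifferentiableAt_sub_section h₁ h₂)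
        (ev.mono fun y hy ↦ by simp [hy])
    rw [← W.torsionFree X _ x (hX.differentiableFieldAt hu hx) hd,
      W.nabla_congr hd (mdifferentiableAt_sub_section h₁ h₂) ev, W.nabla_sub h₁ h₂]
    rfl
  have two {X : Π x : M, TangentSpace (𝓡 n) x} (hX : SmoothFieldOn X u) :
      ContMDiffAt (𝓡 n) ((𝓡 n).prod 𝓘(ℝ, EuclideanSpace ℝ (Fin n))) (minSmoothness ℝ 2)
        (fun y ↦ TotalSpace.mk' (EuclideanSpace ℝ (Fin n)) y (X y)) x := by
    refine (hX.contMDiffAt (hu.mem_nhds hx)).of_le ?_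
    rw [minSmoothness_of_isRCLikeNormedField]
    exact ENat.LEInfty.out
  have : IsManifold (𝓡 n) (minSmoothness ℝ 3) M := by
    rw [minSmoothness_of_isRCLikeNormedField]
    exact .of_le (n := ∞) ENat.LEInfty.out
  have jac := VectorField.leibniz_identity_mlieBracket_apply (two hX) (two hY) (two hZ)
  rw [VectorField.mlieBracket_swap_apply (V := VectorField.mlieBracket (𝓡 n) X Y),
    ← key hX hY hZ, ← key hZ hX hY, ← key hY hX hZ,
    VectorField.mlieBracket_swap_apply (V := X) (W := Z), map_neg, ← sub_eq_zero] at jac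
  simp only [curvature]
  rw [← jac]
  abel

end WeylStructure

/-! ### Derivatives of functions with values in a space of matrices -/

section Manifold

variable {n : ℕ} {M : Type*} [TopologicalSpace M] [ChartedSpace (EuclideanSpace ℝ (Fin n)) M]
  {x : M}

theorem mvfderiv_sum_const_smul {ι : Type} [Fintype ι] {c : ι → ℝ} {f : ι → M → ℝ}
    (hf : ∀ i, MDifferentiableAt (𝓡 n) 𝓘(ℝ, ℝ) (f i) x) :
    mvfderiv (𝓡 n) (∑ i, c i • f i) x = ∑ i, c i • mvfderiv (𝓡 n) (f i) x :=
  (HasMFDerivAt.sum fun i (_ : i ∈ Finset.univ) ↦ (hf i).hasMFDerivAt.const_smul (c i)).mfderiv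

/-- The entrywise derivative of a matrix-valued function with values in a linear subspace lies in
that subspace. -/
theorem of_mvfderiv_mem {m : ℕ} (H : Submodule ℝ (Matrix (Fin m) (Fin m) ℝ))
    {A : M → Matrix (Fin m) (Fin m) ℝ} (hA : ∀ᶠ y in 𝓝 x, A y ∈ H)
    (hd : ∀ i j, MDifferentiableAt (𝓡 n) 𝓘(ℝ, ℝ) (fun y ↦ A y i j) x)
    (v : TangentSpace (𝓡 n) x) :
    Matrix.of (fun i j ↦ mvfderiv (𝓡 n) (fun y ↦ A y i j) x v) ∈ H := by
  -- The subspace is the common kernel of the functionals `φ` in its annihilator, and `φ` commutes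
  -- with the derivative.
  refine (Subspace.forall_mem_dualAnnihilator_apply_eq_zero_iff H _).mp fun φ hφ ↦ ?_
  have expand (B : Matrix (Fin m) (Fin m) ℝ) :
      φ B = ∑ p : Fin m × Fin m, φ (Matrix.single p.1 p.2 1) • B p.1 p.2 := by
    conv_lhs => rw [Matrix.matrix_eq_sum_single B]
    simp only [map_sum, Fintype.sum_prod_type]
    refine Finset.sum_congr rfl fun i _ ↦ Finset.sum_congr rfl fun j _ ↦ ?_
    rw [← mul_one (B i j), ← smul_eq_mul, ← Matrix.smul_single, map_smul]
    simp [mul_comm]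
  have h := mvfderiv_sum_const_smul (x := x)
    (c := fun p : Fin m × Fin m ↦ φ (Matrix.single p.1 p.2 1)) fun p ↦ hd p.1 p.2
  have hz : (∑ p : Fin m × Fin m, φ (Matrix.single p.1 p.2 1) • fun y ↦ A y p.1 p.2)
      =ᶠ[𝓝 x] (fun _ ↦ (0 : ℝ)) := by
    filter_upwards [hA] with y hy
    rw [Submodule.mem_dualAnnihilator] at hφ
    have h0 := hφ _ hy
    rw [expand] at h0
    simpa using h0
  have h0 : mvfderiv (𝓡 n) (∑ p : Fin m × Fin m, φ (Matrix.single p.1 p.2 1) •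
      fun y ↦ A y p.1 p.2) x = 0 := by
    rw [mvfderiv, hz.mfderiv_eq, mfderiv_const]
    exact ContinuousLinearMap.comp_zero _
  have h' := congr($(h.symm.trans h0) v)
  rw [expand]
  simpa using h'

end Manifold

/-! ### The curvature in a conformal frame -/

namespace WeylStructure

variable {n : ℕ} {M : Type*} [TopologicalSpace M] [ChartedSpace (EuclideanSpace ℝ (Fin n)) M]
  [IsManifold (𝓡 n) ∞ M] (W : WeylStructure n M)
  {u : Set M} {x : M} {X Y Z : Π x : M, TangentSpace (𝓡 n) x}
  {e : Fin n → Π x : M, TangentSpace (𝓡 n) x}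

theorem nabla_smul {f : M → ℝ} (hf : MDifferentiableAt (𝓡 n) 𝓘(ℝ, ℝ) f x)
    (hX : DifferentiableFieldAt X x) (v : TangentSpace (𝓡 n) x) :
    W.nabla (f • X) x v = f x • W.nabla X x v + mvfderiv (𝓡 n) f x v • X x := by
  have h := W.nabla.isCovariantDerivativeOnUniv.leibniz (x := x) hX hf
  exact congr($h v)

theorem nabla_sum_smul {ι : Type*} (s : Finset ι) {f : ι → M → ℝ}
    {X : ι → Π x : M, TangentSpace (𝓡 n) x}
    (hf : ∀ i, MDifferentiableAt (𝓡 n) 𝓘(ℝ, ℝ) (f i) x)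
    (hX : ∀ i, DifferentiableFieldAt (X i) x) (v : TangentSpace (𝓡 n) x) :
    W.nabla (fun y ↦ ∑ i ∈ s, f i y • X i y) x v
      = ∑ i ∈ s, (f i x • W.nabla (X i) x v + mvfderiv (𝓡 n) (f i) x v • X i x) := by
  classical
  induction s using Finset.induction_on with
  | empty =>
    have h : W.nabla (0 : Π x : M, TangentSpace (𝓡 n) x) = 0 := CovariantDerivative.zero W.nabla
    exact congr($h x v)
  | insert i s hi ih =>
    have h := W.nabla.isCovariantDerivativeOnUniv.add (x := x)
      (MDifferentiableAt.smul_section (hf i) (hX i))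
      (MDifferentiableAt.sum_section (s := s) fun i _ ↦
        MDifferentiableAt.smul_section (hf i) (hX i))
    simp only [Finset.sum_insert hi]
    rw [← ih, ← W.nabla_smul (hf i) (hX i)]
    exact congr($h v)

theorem IsConformalFrame.coeff_eq_div {W : WeylStructure n M} (hc : W.IsConformalFrame e u)
    (he : IsLocalFrameOn (𝓡 n) (EuclideanSpace ℝ (Fin n)) ∞ e u)
    {g : ContMDiffRiemannianMetric (𝓡 n) ∞ (EuclideanSpace ℝ (Fin n))
      (TangentSpace (𝓡 n) : M → Type _)} (hg : g ∈ W.metrics) (hx : x ∈ u) (i : Fin n)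
    (v : TangentSpace (𝓡 n) x) :
    he.coeff i x v = g.inner x v (e i x) / g.inner x (e i x) (e i x) := by
  obtain ⟨r, hr, h⟩ := hc g hg x hx
  have hg' (j k : Fin n) : g.inner x (e j x) (e k x) = if j = k then r else 0 := by
    have := congr($h j k)
    simpa [gram, Matrix.one_apply] using this
  have hv : v = ∑ k, he.coeff k x v • e k x := by
    simpa [IsLocalFrameOn.coeff, hx] using ((he.toBasisAt hx).sum_repr v).symm
  conv_rhs => rw [hv]
  simp [hg', hr.ne']

theorem mdifferentiableAt_inner
    (g : ContMDiffRiemannianMetric (𝓡 n) ∞ (EuclideanSpace ℝ (Fin n))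
      (TangentSpace (𝓡 n) : M → Type _)) (hX : DifferentiableFieldAt X x)
    (hY : DifferentiableFieldAt Y x) :
    MDifferentiableAt (𝓡 n) 𝓘(ℝ, ℝ) (fun y ↦ g.inner y (X y) (Y y)) x := by
  have h : MDifferentiableAt (𝓡 n) ((𝓡 n).prod 𝓘(ℝ))
      (fun y ↦ TotalSpace.mk' ℝ (E := Bundle.Trivial M ℝ) y (g.inner y (X y) (Y y))) x :=
    MDifferentiableAt.clm_bundle_apply₂ (F₁ := EuclideanSpace ℝ (Fin n))
      (F₂ := EuclideanSpace ℝ (Fin n)) (g.contMDiff.mdifferentiableAt (by simp)) hX hY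
  simp only [mdifferentiableAt_totalSpace] at h
  exact h.2

/-- The frame coefficients of a differentiable vector field are differentiable, being quotients
of inner products. -/
theorem IsConformalFrame.mdifferentiableAt_coeff {W : WeylStructure n M}
    (hc : W.IsConformalFrame e u)
    (he : IsLocalFrameOn (𝓡 n) (EuclideanSpace ℝ (Fin n)) ∞ e u) (hu : IsOpen u) (hx : x ∈ u)
    (hX : DifferentiableFieldAt X x) (i : Fin n) :
    MDifferentiableAt (𝓡 n) 𝓘(ℝ, ℝ) (fun y ↦ he.coeff i y (X y)) x := by
  obtain ⟨g, hg⟩ := W.nonempty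
  have hi : DifferentiableFieldAt (e i) x :=
    SmoothFieldOn.differentiableFieldAt (he.contMDiffOn i) hu hx
  have h := (mdifferentiableAt_inner g hX hi).div (mdifferentiableAt_inner g hi hi)
    (g.pos x _ ((he.linearIndependent hx).ne_zero i)).ne'
  refine h.congr_of_eventuallyEq ?_
  filter_upwards [hu.mem_nhds hx] with y hy
  exact hc.coeff_eq_div he hg hy i _

theorem coeff_frame (he : IsLocalFrameOn (𝓡 n) (EuclideanSpace ℝ (Fin n)) ∞ e u) (hx : x ∈ u)
    (i j : Fin n) : he.coeff i x (e j x) = (1 : Matrix (Fin n) (Fin n) ℝ) i j := by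
  have h := (he.toBasisAt hx).repr_self_apply j i
  simp only [IsLocalFrameOn.toBasisAt_coe] at h
  simp [IsLocalFrameOn.coeff, hx, h, Matrix.one_apply, eq_comm]

/-- In terms of the connection matrix `Γ`, the components of `∇_v ∇_Y e_j` are the entries of the
`j`-th column of `v(Γ(Y)) + Γ(v) Γ(Y)`. -/
theorem coeff_nabla_nabla (hc : W.IsConformalFrame e u)
    (he : IsLocalFrameOn (𝓡 n) (EuclideanSpace ℝ (Fin n)) ∞ e u) (hu : IsOpen u) (hx : x ∈ u)
    (hY : SmoothFieldOn Y u) (v : TangentSpace (𝓡 n) x) (k j : Fin n) :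
    he.coeff k x (W.nabla (fun y ↦ W.nabla (e j) y (Y y)) x v)
      = mvfderiv (𝓡 n) (fun y ↦ W.connectionMatrix he y (Y y) k j) x v
        + (W.connectionMatrix he x v * W.connectionMatrix he x (Y x)) k j := by
  have hd : DifferentiableFieldAt (fun y ↦ W.nabla (e j) y (Y y)) x :=
    (W.smoothFieldOn_nabla hu (he.contMDiffOn j) hY).differentiableFieldAt hu hx
  have hed (i : Fin n) : DifferentiableFieldAt (e i) x :=
    SmoothFieldOn.differentiableFieldAt (he.contMDiffOn i) hu hx
  have hcd := hc.mdifferentiableAt_coeff he hu hx hd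
  have hs : W.nabla (fun y ↦ W.nabla (e j) y (Y y)) x v
      = ∑ i, (he.coeff i x (W.nabla (e j) x (Y x)) • W.nabla (e i) x v
        + mvfderiv (𝓡 n) (fun y ↦ he.coeff i y (W.nabla (e j) y (Y y))) x v • e i x) := by
    rw [← W.nabla_sum_smul _ hcd hed]
    exact congr($(W.nabla_congr hd (MDifferentiableAt.sum_section fun i _ ↦
      MDifferentiableAt.smul_section (hcd i) (hed i))
      (he.eventually_eq_sum_coeff_smul _ (hu.mem_nhds hx))) v)
  rw [hs, map_sum]
  simp only [map_add, map_smul, coeff_frame he hx, Finset.sum_add_distrib, Matrix.mul_apply]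
  rw [add_comm]
  simp [connectionMatrix, Matrix.one_apply, mul_comm]

/-- The structure equation `R(X, Y) = X(Γ(Y)) - Y(Γ(X)) + [Γ(X), Γ(Y)] - Γ([X, Y])` shows that the
matrix of `R(X, Y)` lies in `h` when the connection matrix does. -/
theorem curvature_coeff_mem (hc : W.IsConformalFrame e u)
    (he : IsLocalFrameOn (𝓡 n) (EuclideanSpace ℝ (Fin n)) ∞ e u) (hu : IsOpen u) (hx : x ∈ u)
    (h : LieSubalgebra ℝ (Matrix (Fin n) (Fin n) ℝ))
    (hh : ∀ y ∈ u, ∀ v : TangentSpace (𝓡 n) y, W.connectionMatrix he y v ∈ h)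
    (hX : SmoothFieldOn X u) (hY : SmoothFieldOn Y u) :
    Matrix.of (fun k j ↦ he.coeff k x (W.curvature X Y (e j) x)) ∈ h := by
  have hd {Y : Π x : M, TangentSpace (𝓡 n) x} (hY : SmoothFieldOn Y u)
      (v : TangentSpace (𝓡 n) x) :
      Matrix.of (fun k j ↦ mvfderiv (𝓡 n)
        (fun y ↦ W.connectionMatrix he y (Y y) k j) x v) ∈ h :=
    of_mvfderiv_mem h.toSubmodule
      (by filter_upwards [hu.mem_nhds hx] with y hy using hh y hy _)
      (fun i j ↦ hc.mdifferentiableAt_coeff he hu hx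
        ((W.smoothFieldOn_nabla hu (he.contMDiffOn j) hY).differentiableFieldAt hu hx) i) v
  have key := h.sub_mem (h.add_mem (h.sub_mem (hd hY (X x)) (hd hX (Y x)))
    (h.lie_mem (hh x hx (X x)) (hh x hx (Y x))))
    (hh x hx (VectorField.mlieBracket (𝓡 n) X Y x))
  convert! key using 1
  ext k j
  simp only [curvature, map_sub, Matrix.of_apply, W.coeff_nabla_nabla hc he hu hx hX,
    W.coeff_nabla_nabla hc he hu hx hY, Ring.lie_def, Matrix.sub_apply, Matrix.add_apply]
  simp only [connectionMatrix, Matrix.of_apply]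
  ring

end WeylStructure

/-! ### Vanishing of the curvature -/

namespace WeylStructure

variable {n : ℕ} {M : Type*} [TopologicalSpace M] [ChartedSpace (EuclideanSpace ℝ (Fin n)) M]
  [IsManifold (𝓡 n) ∞ M] (W : WeylStructure n M)
  {u : Set M} {x : M} {X Y Z : Π x : M, TangentSpace (𝓡 n) x}
  {e : Fin n → Π x : M, TangentSpace (𝓡 n) x}

theorem _root_.TensorialAt.eq_zero_of_frame
    {Φ : (Π x : M, TangentSpace (𝓡 n) x) → TangentSpace (𝓡 n) x}
    (hΦ : TensorialAt (𝓡 n) (EuclideanSpace ℝ (Fin n)) Φ x)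
    (he : IsLocalFrameOn (𝓡 n) (EuclideanSpace ℝ (Fin n)) ∞ e u) (hu : IsOpen u) (hx : x ∈ u)
    (h0 : ∀ i, Φ (e i) = 0) (hX : DifferentiableFieldAt X x) : Φ X = 0 := by
  have hed (i : Fin n) : DifferentiableFieldAt (e i) x :=
    SmoothFieldOn.differentiableFieldAt (he.contMDiffOn i) hu hx
  have hc (i : Fin n) : MDifferentiableAt (𝓡 n) 𝓘(ℝ, ℝ) (fun _ : M ↦ he.coeff i x (X x)) x :=
    mdifferentiableAt_const
  have hs (i : Fin n) : DifferentiableFieldAt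
      ((fun _ : M ↦ he.coeff i x (X x)) • e i) x := MDifferentiableAt.smul_section (hc i) (hed i)
  rw [hΦ.pointwise hX (MDifferentiableAt.sum_section (s := Finset.univ) fun i _ ↦ hs i)
      (he.coeff_sum_eq X hx), hΦ.sum _ fun i _ ↦ hs i]
  exact Finset.sum_eq_zero fun i _ ↦ by rw [hΦ.smul (hc i) (hed i), h0 i, smul_zero]

/-- The curvature vanishes at a point if its components in a local frame do. -/
theorem curvature_eq_zero_of_frame (he : IsLocalFrameOn (𝓡 n) (EuclideanSpace ℝ (Fin n)) ∞ e u)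
    (hu : IsOpen u) (hx : x ∈ u) (h0 : ∀ a b c, W.curvature (e a) (e b) (e c) x = 0)
    (hX : SmoothFieldOn X u) (hY : SmoothFieldOn Y u) (hZ : SmoothFieldOn Z u) :
    W.curvature X Y Z x = 0 := by
  -- For fixed `Z`, tensoriality in `X` and `Y` allows them to be replaced by frame fields.
  have extend {Z : Π x : M, TangentSpace (𝓡 n) x} (hZ : SmoothFieldOn Z u)
      (h : ∀ a b, W.curvature (e a) (e b) Z x = 0) {X Y : Π x : M, TangentSpace (𝓡 n) x}
      (hX : SmoothFieldOn X u) (hY : SmoothFieldOn Y u) : W.curvature X Y Z x = 0 :=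
    (W.tensorialAt_curvature_left hu hx hZ).eq_zero_of_frame he hu hx
      (fun a ↦ (W.tensorialAt_curvature_right hu hx hZ).eq_zero_of_frame he hu hx (h a)
        (hY.differentiableFieldAt hu hx)) (hX.differentiableFieldAt hu hx)
  have he' (i : Fin n) : SmoothFieldOn (e i) u := he.contMDiffOn i
  -- By the cyclic identity, `R(e_a, e_b) Z = -R(e_b, Z) e_a - R(Z, e_a) e_b`, so that `Z` too is now
  -- in a tensorial slot.
  refine extend hZ (fun a b ↦ ?_) hX hY
  have hcyc := W.curvature_cyclic hu hx (he' a) (he' b) hZ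
  rwa [extend (he' a) (fun _ _ ↦ h0 _ _ _) (he' b) hZ,
    extend (he' b) (fun _ _ ↦ h0 _ _ _) hZ (he' a), add_zero, add_zero] at hcyc

/-- The trace term of the Einstein-Weyl equations in a conformal frame: the conformal factor `r`
cancels between `g_ij` and its inverse. -/
theorem scalar_mul_gram (he : IsLocalFrameOn (𝓡 n) (EuclideanSpace ℝ (Fin n)) ∞ e u)
    {g : ContMDiffRiemannianMetric (𝓡 n) ∞ (EuclideanSpace ℝ (Fin n))
      (TangentSpace (𝓡 n) : M → Type _)} {r : ℝ} (hr : 0 < r)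
    (hg : gram g e x = r • (1 : Matrix (Fin n) (Fin n) ℝ)) (i j : Fin n) :
    W.scalar g he x * gram g e x i j
      = (∑ l, W.ricci he x l l) * (1 : Matrix (Fin n) (Fin n) ℝ) i j := by
  have hinv : (r • (1 : Matrix (Fin n) (Fin n) ℝ))⁻¹ = r⁻¹ • 1 :=
    Matrix.inv_eq_left_inv (by simp [hr.ne'])
  rw [scalar, hg, hinv]
  simp only [Matrix.smul_apply, Matrix.one_apply, smul_eq_mul, mul_ite, mul_one, mul_zero,
    Finset.sum_ite_eq, Finset.mem_univ, if_true, ← Finset.sum_mul]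
  split_ifs <;> field_simp

end WeylStructure

theorem proposition1 {M : Type*} [TopologicalSpace M] [T2Space M]
    [ChartedSpace (EuclideanSpace ℝ (Fin 3)) M] [IsManifold (𝓡 3) ∞ M]
    (W : WeylStructure 3 M) (h : LieSubalgebra ℝ (Matrix (Fin 3) (Fin 3) ℝ))
    (h_proper : h < conformalLieAlgebra 3)
    (h_ne_so : h ≠ LieAlgebra.Orthogonal.so (Fin 3) ℝ)
    (hol : W.HolonomyReducedTo h)
    (ew : W.IsEinsteinWeyl) :
    W.IsFlat := by
  intro u X Y Z hu hX hY hZ x hx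
  obtain ⟨N, hN, hspan⟩ := exists_rotation_generator h_proper h_ne_so
  obtain ⟨u', e, he, hu', hx', hc, hconn⟩ := hol x
  have hes (i : Fin 3) : SmoothFieldOn (e i) u' := he.contMDiffOn i
  refine W.curvature_eq_zero_of_frame (he.mono inter_subset_right) (hu.inter hu') ⟨hx, hx'⟩ ?_
    (hX.mono inter_subset_left) (hY.mono inter_subset_left) (hZ.mono inter_subset_left)
  let R : Fin 3 → Fin 3 → Matrix (Fin 3) (Fin 3) ℝ := fun a b ↦
    Matrix.of fun k c ↦ he.coeff k x (W.curvature (e a) (e b) (e c) x)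
  have hR0 (a b : Fin 3) : R a b = 0 := by
    refine curvature_components_eq_zero hN (fun a b ↦ hspan _
      (W.curvature_coeff_mem hc he hu' hx' h hconn (hes a) (hes b))) (fun a b ↦ ?_)
      (fun a b c k ↦ ?_) (fun i j ↦ ?_) a b
    · ext k c
      simp only [Matrix.of_apply, Matrix.neg_apply, ← map_neg]
      rw [W.curvature_swap]
    · simp only [Matrix.of_apply, ← map_add]
      rw [W.curvature_cyclic hu' hx' (hes a) (hes b) (hes c), map_zero]
    · obtain ⟨g, hg⟩ := W.nonempty
      obtain ⟨r, hr, hgram⟩ := hc g hg x hx'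
      have h_ew := ew g hg u' e hu' he x hx' i j
      rw [mul_assoc, W.scalar_mul_gram he hr hgram, ← mul_assoc] at h_ew
      exact_mod_cast h_ew
  intro a b c
  have hcoeff (k : Fin 3) : he.coeff k x (W.curvature (e a) (e b) (e c) x) = 0 :=
    congr($(hR0 a b) k c)
  rw [he.coeff_sum_eq (W.curvature (e a) (e b) (e c)) hx']
  simp only [hcoeff, zero_smul, Finset.sum_const_zero]
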